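/- Theorem 1.3. For a ring $R$ and $x=(x_1,x_2),\ y=(y_1,y_2)\in R^2$ put $y^\perp=(y_2,-y_1)$, so that $x\cdot y^\perp=x_1y_2-x_2y_1$. For $E\subset R^2$ and an integer $k\ge 0$, two $(k+1)$-point configurations $(x^1,\dots,x^{k+1}),(y^1,\dots,y^{k+1})\in E^{k+1}$ are called equivalent if $x^i\cdot x^{j\perp}=y^i\cdot y^{j\perp}$ for all $i,j\in\{1,\dots,k+1\}$; let $\mathcal{C}_{k+1}(E)$ denote the set of equivalence classes of $E^{k+1}$ under this relation. For every integer $k\ge 0$ and every real $C>0$ there is a real $c>0$, depending only on $k$ and $C$, such that the following holds for every odd prime $p$ and every integer $\ell\ge 1$. Put $s=2-\frac{1}{\ell(k+1)}$. If $E\subset(\mathbb{Z}/p^\ell\mathbb{Z})^2$ satisfies $$|E|\ \ge\ C\,\ell^{\frac{2}{k+1}}\,p^{\ell s},$$ then $$|\mathcal{C}_{k+1}(E)|\ \ge\ c\,\bigl|\mathcal{C}_{k+1}\bigl((\mathbb{Z}/p^\ell\mathbb{Z})^2\bigr)\bigr|.$$ -/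

import Mathlib

/-- For `y = (y₁, y₂)` in `R²`, the vector `y^⊥ = (y₂, -y₁)`,
so that `x · y^⊥ = x₁ y₂ - x₂ y₁`. -/
def perp {R : Type*} [Ring R] (y : Fin 2 → R) : Fin 2 → R :=
  ![y 1, -y 0]

/-- The equivalence relation on `n`-point configurations in `E ⊆ R²`: `x ∼ y` if and only if
`x^i · x^{j⊥} = y^i · y^{j⊥}` for every pair of indices `i, j`. -/
def configSetoid {R : Type*} [Ring R] (n : ℕ) (E : Set (Fin 2 → R)) :
    Setoid (Fin n → E) where
  r x y := ∀ i j : Fin n,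
    dotProduct (x i : Fin 2 → R) (perp (x j : Fin 2 → R)) =
      dotProduct (y i : Fin 2 → R) (perp (y j : Fin 2 → R))
  iseqv :=
    ⟨fun _ _ _ => rfl, fun h i j => (h i j).symm, fun h h' i j => (h i j).trans (h' i j)⟩

/-- `𝒞_n(E)`: the set of equivalence classes of `n`-point configurations in `E`. -/
def ConfigClasses {R : Type*} [Ring R] (n : ℕ) (E : Set (Fin 2 → R)) : Type _ :=
  Quotient (configSetoid n E)

/-! Write q = p^ℓ and n = k + 1. A class is the same thing as a matrix of pairwise determinants
(`natCard_configClasses`), so for n ≥ 2 it suffices that the plane has at most a constant times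
q^(2n-3) such matrices and E at least a constant times as many.

Upper bound (`card_image_gram_le`): let p^t be the largest power of p, t ≤ ℓ, dividing all entries.
By the Plücker relation, two rows meeting in an entry of least valuation determine the rest, leaving
2n-3 free multiples of p^t. The sum over t is geometric.

Lower bound (`pow_le_card_image_gram`): discard the non-primitive points of E and keep the
configurations whose first two points have unit determinant. Two of these with equal matrices differ
by some g in SL₂, so Cauchy–Schwarz bounds the number of classes below by |E|^(2n), up to a
constant, over the n-th moment of r(g) = |{x ∈ E : gx ∈ E}|. About |E|²/q², the second moment of r
is governed by the energy counting x ∧ x' = y ∧ y' in E, whose main term |E|⁴/q cancels; the error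
is at most 2ℓ|E|²q³/p (`sum_returnCount_sub_sq_zmod_le`). The size hypothesis makes this harmless.

The argument needs p large in terms of n and C. For smaller p the hypothesis bounds ℓ, hence q, and
a single class suffices. -/

open Finset

/-! ### Determinants of pairs of vectors and the action of matrices -/

section Wedge

variable {R : Type*} [CommRing R]

/-- The determinant of the pair `x, y`. -/
def wedge (x y : Fin 2 → R) : R := x 0 * y 1 - x 1 * y 0

lemma dotProduct_perp (x y : Fin 2 → R) : dotProduct x (perp y) = wedge x y := by
  simp [dotProduct, perp, wedge, Fin.sum_univ_two]; ring

/-- A vector of `R²` with a unit coordinate. -/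
def IsPrimitiveVec (x : Fin 2 → R) : Prop := IsUnit (x 0) ∨ IsUnit (x 1)

/-- The matrix with columns `g.1, g.2` applied to `x`. -/
def act (g : (Fin 2 → R) × (Fin 2 → R)) (x : Fin 2 → R) : Fin 2 → R := x 0 • g.1 + x 1 • g.2

lemma wedge_act (g : (Fin 2 → R) × (Fin 2 → R)) (x y : Fin 2 → R) :
    wedge (act g x) (act g y) = wedge g.1 g.2 * wedge x y := by
  simp [wedge, act]; ring

lemma wedge_sub_right (x y z : Fin 2 → R) : wedge x (y - z) = wedge x y - wedge x z := by
  simp [wedge]; ring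

lemma wedge_smul_right (c : R) (x y : Fin 2 → R) : wedge x (c • y) = c * wedge x y := by
  simp [wedge]; ring

lemma wedge_swap (x y : Fin 2 → R) : wedge x y = -wedge y x := by
  simp [wedge]; ring

lemma wedge_plucker (x y z w : Fin 2 → R) :
    wedge x y * wedge z w = wedge x z * wedge y w - wedge x w * wedge y z := by
  simp [wedge]; ring

lemma isPrimitiveVec_of_wedge [IsLocalRing R] {x y : Fin 2 → R}
    (h : IsUnit (wedge x y)) : IsPrimitiveVec x := by
  by_contra hx
  simp only [IsPrimitiveVec, not_or] at hx
  have h0 : x 0 * y 1 ∈ nonunits R := fun h => hx.1 (isUnit_of_mul_isUnit_left h)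
  have h1 : -(x 1 * y 0) ∈ nonunits R := fun h => hx.2 (isUnit_of_mul_isUnit_left (by simpa using h))
  have := IsLocalRing.nonunits_add h0 h1
  exact this (by simpa [wedge, sub_eq_add_neg] using h)

/-- Cramer's rule for the columns of a matrix. -/
lemma act_eq_of_wedge {g : (Fin 2 → R) × (Fin 2 → R)} {x x' y y' : Fin 2 → R}
    (hx : act g x = y) (hx' : act g x' = y') :
    wedge x x' • g.1 = x' 1 • y - x 1 • y' ∧ wedge x x' • g.2 = x 0 • y' - x' 0 • y := by
  subst hx hx'
  constructor <;> · ext i; simp [act, wedge]; ring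

lemma eq_of_act_eq {g h : (Fin 2 → R) × (Fin 2 → R)} {x x' : Fin 2 → R}
    (hu : IsUnit (wedge x x')) (hx : act g x = act h x) (hx' : act g x' = act h x') : g = h := by
  obtain ⟨a, b⟩ := act_eq_of_wedge hx hx'
  obtain ⟨a', b'⟩ := act_eq_of_wedge (g := h) (x := x) (x' := x') rfl rfl
  exact Prod.ext (hu.smul_left_cancel.1 (a.trans a'.symm)) (hu.smul_left_cancel.1 (b.trans b'.symm))

/-- Two configurations with the same wedges, one of which is a unit, differ by a matrix of
determinant one. -/
lemma exists_act_eq {ι : Type*} {x y : ι → Fin 2 → R}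
    (h : ∀ i j, wedge (x i) (x j) = wedge (y i) (y j)) {i j : ι} (hu : IsUnit (wedge (x i) (x j))) :
    ∃ g : (Fin 2 → R) × (Fin 2 → R), wedge g.1 g.2 = 1 ∧ ∀ a, act g (x a) = y a := by
  obtain ⟨u, hu⟩ := hu
  have hd : (↑u⁻¹ : R) * wedge (x i) (x j) = 1 := by rw [← hu]; simp
  set d : R := ↑u⁻¹
  refine ⟨(d • (x j 1 • y i - x i 1 • y j), d • (x i 0 • y j - x j 0 • y i)), ?_, fun a => ?_⟩
  · have h1 := h i j
    have : wedge (d • (x j 1 • y i - x i 1 • y j)) (d • (x i 0 • y j - x j 0 • y i))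
        = d * d * (wedge (x i) (x j) * wedge (y i) (y j)) := by
      simp [wedge]; ring
    rw [this, ← h1]
    linear_combination (d * wedge (x i) (x j) + 1) * hd
  · have e1 := h i a
    have e2 := h a j
    have e3 := h i j
    have e4 : ∀ b, wedge (y i) (y j) * y a b = wedge (y a) (y j) * y i b + wedge (y i) (y a) * y j b := by
      intro b; fin_cases b <;> simp [wedge] <;> ring
    ext b
    have : act (d • (x j 1 • y i - x i 1 • y j), d • (x i 0 • y j - x j 0 • y i)) (x a) b
      = d * (wedge (x a) (x j) * y i b + wedge (x i) (x a) * y j b) := by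
      simp [act, wedge]; ring
    rw [this, e1, e2, ← e4, ← e3, ← mul_assoc, hd, one_mul]

end Wedge

/-! ### Counting in SL₂ over a finite ring -/

section Count

variable {R : Type*} [CommRing R] [Fintype R] [DecidableEq R]

lemma card_wedge_eq {y : Fin 2 → R} (hy : IsPrimitiveVec y) (c : R) :
    #{v : Fin 2 → R | wedge y v = c} = Fintype.card R := by
  rw [← Finset.card_univ]
  rcases hy with ⟨u, hu⟩ | ⟨u, hu⟩
  · refine Finset.card_nbij' (fun v => v 0) (fun t => ![t, ↑u⁻¹ * (c + y 1 * t)]) ?_ ?_ ?_ ?_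
    · simp
    · intro t _; simp [wedge, ← hu]
    · intro v hv
      replace hv := (Finset.mem_filter.1 hv).2
      simp only [wedge] at hv
      ext b; fin_cases b
      · simp
      · simp [← hv, ← hu]
    · intro t _; simp
  · refine Finset.card_nbij' (fun v => v 1) (fun t => ![↑u⁻¹ * (y 0 * t - c), t]) ?_ ?_ ?_ ?_
    · simp
    · intro t _; simp [wedge, ← hu]
    · intro v hv
      replace hv := (Finset.mem_filter.1 hv).2
      simp only [wedge] at hv
      ext b; fin_cases b
      · simp [← hv, ← hu]
      · simp
    · intro t _; simp

variable (R) in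
/-- The pairs of vectors of determinant one, i.e. the columns of the elements of `SL₂(R)`. -/
def unimodularPairs : Finset ((Fin 2 → R) × (Fin 2 → R)) := {g | wedge g.1 g.2 = 1}

lemma mem_unimodularPairs {g : (Fin 2 → R) × (Fin 2 → R)} :
    g ∈ unimodularPairs R ↔ wedge g.1 g.2 = 1 := by simp [unimodularPairs]

/-- If, say, `x 0` is a unit, then `act g x = y` gives the first column in terms of the second, and
the determinant condition becomes `wedge y g.2 = x 0`, which is counted by `card_wedge_eq`. -/
lemma card_act_eq {x y : Fin 2 → R} (hx : IsPrimitiveVec x) (hy : IsPrimitiveVec y) :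
    #{g ∈ unimodularPairs R | act g x = y} = Fintype.card R := by
  rcases hx with ⟨u, hu⟩ | ⟨u, hu⟩
  · rw [← card_wedge_eq hy (u : R)]
    refine Finset.card_nbij' (fun g => g.2) (fun v => ((↑u⁻¹ : R) • (y - x 1 • v), v)) ?_ ?_ ?_ ?_
    · intro g hg
      simp only [coe_filter, mem_unimodularPairs, Set.mem_ofPred_eq, mem_univ, true_and] at hg ⊢
      rw [← hg.2, hu]
      have := hg.1
      simp only [act, wedge, Pi.add_apply, Pi.smul_apply, smul_eq_mul] at this ⊢
      linear_combination x 0 * this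
    · intro v hv
      simp only [coe_filter, mem_unimodularPairs, Set.mem_ofPred_eq, mem_univ, true_and] at hv ⊢
      constructor
      · have : (↑u⁻¹ : R) * u = 1 := by simp
        simp only [wedge, Pi.sub_apply, Pi.smul_apply, smul_eq_mul] at hv ⊢
        linear_combination ↑u⁻¹ * hv + this
      · ext b; simp [act, ← hu]
    · intro g hg
      simp only [coe_filter, mem_unimodularPairs, Set.mem_ofPred_eq] at hg
      refine Prod.ext ?_ rfl
      ext b; simp [← hg.2, act, ← hu]
    · intro v _; rfl
  · rw [← card_wedge_eq hy (-u : R)]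
    refine Finset.card_nbij' (fun g => g.1) (fun v => (v, (↑u⁻¹ : R) • (y - x 0 • v))) ?_ ?_ ?_ ?_
    · intro g hg
      simp only [coe_filter, mem_unimodularPairs, Set.mem_ofPred_eq, mem_univ, true_and] at hg ⊢
      rw [← hg.2, hu]
      have := hg.1
      simp only [act, wedge, Pi.add_apply, Pi.smul_apply, smul_eq_mul] at this ⊢
      linear_combination - x 1 * this
    · intro v hv
      simp only [coe_filter, mem_unimodularPairs, Set.mem_ofPred_eq, mem_univ, true_and] at hv ⊢
      constructor
      · have : (↑u⁻¹ : R) * u = 1 := by simp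
        simp only [wedge, Pi.sub_apply, Pi.smul_apply, smul_eq_mul] at hv ⊢
        linear_combination -↑u⁻¹ * hv + this
      · ext b; simp [act, ← hu]
    · intro g hg
      simp only [coe_filter, mem_unimodularPairs, Set.mem_ofPred_eq] at hg
      refine Prod.ext rfl ?_
      ext b; simp [← hg.2, act, ← hu]
    · intro v _; rfl

/-- Over a local ring the first column must be primitive, and the second then lies on a line of |R|
points. -/
lemma card_unimodularPairs_le [IsLocalRing R] :
    #(unimodularPairs R) ≤ Fintype.card R ^ 3 := by
  have h1 : ∀ u ∈ (univ : Finset (Fin 2 → R)),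
      #{g ∈ unimodularPairs R | g.1 = u} ≤ Fintype.card R := by
    intro u _
    by_cases hu : IsPrimitiveVec u
    · rw [← card_wedge_eq hu 1]
      refine Finset.card_le_card_of_injOn (fun g => g.2) ?_ ?_
      · intro g hg
        simp only [coe_filter, mem_unimodularPairs, Set.mem_ofPred_eq, mem_univ, true_and] at hg ⊢
        rw [← hg.2]; exact hg.1
      · intro g hg h hh e
        simp only [coe_filter, Set.mem_ofPred_eq] at hg hh
        exact Prod.ext (hg.2.trans hh.2.symm) e
    · rw [Finset.filter_eq_empty_iff.2]
      · simp
      · rintro g hg rfl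
        rw [mem_unimodularPairs] at hg
        exact hu (isPrimitiveVec_of_wedge (y := g.2) (by rw [hg]; exact isUnit_one))
  have := Finset.card_le_mul_card_image_of_maps_to (s := unimodularPairs R) (t := univ)
    (f := fun g => g.1) (fun _ _ => mem_univ _) _ h1
  refine this.trans (le_of_eq ?_)
  simp; ring

end Count

/-! ### Moments of the number of points of E returned to E -/

section Moments

variable {R : Type*} [CommRing R] [Fintype R] [DecidableEq R]

/-- The number of points of `E` that `g` sends to `E`. -/
def returnCount (E : Finset (Fin 2 → R)) (g : (Fin 2 → R) × (Fin 2 → R)) : ℕ :=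
  #{x ∈ E | act g x ∈ E}

/-- The number of pairs of pairs of points of `E` with the same wedge. -/
def wedgeEnergy (E : Finset (Fin 2 → R)) : ℕ :=
  ∑ x ∈ E, ∑ x' ∈ E, ∑ y ∈ E, #{y' ∈ E | wedge x x' = wedge y y'}

lemma card_act_mem {E : Finset (Fin 2 → R)} (hE : ∀ x ∈ E, IsPrimitiveVec x) {x : Fin 2 → R}
    (hx : IsPrimitiveVec x) :
    #{g ∈ unimodularPairs R | act g x ∈ E} = #E * Fintype.card R := by
  rw [Finset.card_eq_sum_card_fiberwise (s := {g ∈ unimodularPairs R | act g x ∈ E})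
    (f := fun g => act g x) (t := E) (fun g hg => by simpa using (Finset.mem_filter.1 hg).2), ← smul_eq_mul, ← Finset.sum_const]
  refine Finset.sum_congr rfl fun y hy => ?_
  rw [← card_act_eq hx (hE y hy), Finset.filter_filter]
  congr 1
  refine Finset.filter_congr fun g _ => ⟨fun h => h.2, fun h => ⟨h ▸ hy, h⟩⟩

lemma sum_returnCount {E : Finset (Fin 2 → R)} (hE : ∀ x ∈ E, IsPrimitiveVec x) :
    ∑ g ∈ unimodularPairs R, returnCount E g = #E ^ 2 * Fintype.card R := by
  simp only [returnCount, Finset.card_filter]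
  rw [Finset.sum_comm]
  simp only [← Finset.card_filter]
  rw [Finset.sum_congr rfl fun x hx => card_act_mem hE (hE x hx)]
  simp; ring

/-- A matrix is determined by the images of a spanning pair, and determinant one preserves wedges.
-/
lemma card_act_mem_act_mem_le (E : Finset (Fin 2 → R)) {x x' : Fin 2 → R}
    (h : IsUnit (wedge x x')) :
    #{g ∈ unimodularPairs R | act g x ∈ E ∧ act g x' ∈ E} ≤
      ∑ y ∈ E, #{y' ∈ E | wedge x x' = wedge y y'} := by
  rw [← Finset.card_sigma]
  refine Finset.card_le_card_of_injOn (fun g => ⟨act g x, act g x'⟩) ?_ ?_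
  · intro g hg
    simp only [coe_filter, mem_unimodularPairs, Set.mem_ofPred_eq] at hg
    simp only [coe_sigma, Set.mem_sigma_iff, mem_coe, Finset.mem_filter]
    exact ⟨hg.2.1, hg.2.2, by rw [wedge_act, hg.1, one_mul]⟩
  · intro g hg g' hg' e
    simp only [Sigma.mk.injEq, heq_eq_eq] at e
    exact eq_of_act_eq h e.1 e.2

lemma card_wedge_not_isUnit {x : Fin 2 → R} (hx : IsPrimitiveVec x) [DecidablePred (IsUnit (M := R))] :
    #{x' : Fin 2 → R | ¬ IsUnit (wedge x x')} = #{c : R | ¬ IsUnit c} * Fintype.card R := by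
  rw [Finset.card_eq_sum_card_fiberwise (f := fun x' => wedge x x') (t := {c : R | ¬ IsUnit c})
    (fun g hg => by simpa using hg), ← smul_eq_mul, ← Finset.sum_const]
  refine Finset.sum_congr rfl fun c hc => ?_
  rw [← card_wedge_eq hx c, Finset.filter_filter]
  congr 1
  refine Finset.filter_congr fun g _ => ⟨fun h => h.2, fun h => ⟨?_, h⟩⟩
  rw [h]; simpa using hc

/-- The second moment counts triples (g, x, x'). Pairs with unit wedge contribute to the energy; for
the others the condition on x' is dropped. -/
lemma sum_returnCount_sq_le {E : Finset (Fin 2 → R)} (hE : ∀ x ∈ E, IsPrimitiveVec x)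
    [DecidablePred (IsUnit (M := R))] :
    ∑ g ∈ unimodularPairs R, returnCount E g ^ 2 ≤
      wedgeEnergy E + #E ^ 2 * (#{c : R | ¬ IsUnit c} * Fintype.card R ^ 2) := by
  have h1 : ∑ g ∈ unimodularPairs R, returnCount E g ^ 2 =
      ∑ x ∈ E, ∑ x' ∈ E, #{g ∈ unimodularPairs R | act g x ∈ E ∧ act g x' ∈ E} := by
    simp only [returnCount, Finset.card_filter, sq, Finset.sum_mul_sum]
    rw [Finset.sum_comm]
    refine Finset.sum_congr rfl fun x _ => ?_
    rw [Finset.sum_comm]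
    refine Finset.sum_congr rfl fun x' _ => Finset.sum_congr rfl fun g _ => ?_
    by_cases h : act g x ∈ E <;> by_cases h' : act g x' ∈ E <;> simp [h, h']
  have h2 : ∀ x ∈ E, ∀ x' ∈ E, #{g ∈ unimodularPairs R | act g x ∈ E ∧ act g x' ∈ E} ≤
      ∑ y ∈ E, #{y' ∈ E | wedge x x' = wedge y y'} +
        if ¬ IsUnit (wedge x x') then #E * Fintype.card R else 0 := by
    intro x hx x' hx'
    split_ifs with h
    · exact card_act_mem_act_mem_le E h
    · rw [← card_act_mem hE (hE x hx)]
      refine le_trans (Finset.card_le_card ?_) (Nat.le_add_left _ _)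
      exact Finset.monotone_filter_right _ fun g _ hg => hg.1
  have h3 : ∀ x ∈ E, (∑ x' ∈ E, if ¬ IsUnit (wedge x x') then #E * Fintype.card R else 0) ≤
      #{c : R | ¬ IsUnit c} * Fintype.card R * (#E * Fintype.card R) := by
    intro x hx
    rw [← Finset.sum_filter, Finset.sum_const, smul_eq_mul, ← card_wedge_not_isUnit (hE x hx)]
    gcongr
    exact Finset.subset_univ _
  rw [h1]
  calc _ ≤ ∑ x ∈ E, (∑ x' ∈ E, ∑ y ∈ E, #{y' ∈ E | wedge x x' = wedge y y'} +
        #{c : R | ¬ IsUnit c} * Fintype.card R * (#E * Fintype.card R)) := by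
        refine Finset.sum_le_sum fun x hx => ?_
        refine (Finset.sum_le_sum (h2 x hx)).trans ?_
        rw [Finset.sum_add_distrib]
        exact Nat.add_le_add_left (h3 x hx) _
    _ = _ := by
        rw [Finset.sum_add_distrib, wedgeEnergy]
        simp; ring

/-- The second moment of the return count about `|E|² / |R|²`. -/
lemma sum_returnCount_sub_sq_le [IsLocalRing R] {E : Finset (Fin 2 → R)}
    (hE : ∀ x ∈ E, IsPrimitiveVec x) :
    ∑ g ∈ unimodularPairs R, ((returnCount E g : ℝ) - #E ^ 2 / Fintype.card R ^ 2) ^ 2 ≤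
      (∑ g ∈ unimodularPairs R, (returnCount E g : ℝ) ^ 2) - #E ^ 4 / Fintype.card R := by
  have hq : (0 : ℝ) < Fintype.card R := by exact_mod_cast Fintype.card_pos
  have h1 : ∑ g ∈ unimodularPairs R, (returnCount E g : ℝ) = #E ^ 2 * Fintype.card R := by
    exact_mod_cast sum_returnCount hE
  have h2 : (#(unimodularPairs R) : ℝ) ≤ Fintype.card R ^ 3 := by
    exact_mod_cast card_unimodularPairs_le
  simp only [sub_sq, Finset.sum_add_distrib, Finset.sum_sub_distrib]
  rw [← Finset.sum_mul, ← Finset.mul_sum, h1, Finset.sum_const, nsmul_eq_mul]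
  set q : ℝ := (Fintype.card R : ℝ)
  -- Since |SL₂| ≤ |R|³, centring at |E|²/|R|² instead of the true mean does no harm.
  have h3 : (#(unimodularPairs R) : ℝ) * ((#E : ℝ) ^ 2 / q ^ 2) ^ 2 ≤ #E ^ 4 / q := by
    calc _ ≤ q ^ 3 * ((#E : ℝ) ^ 2 / q ^ 2) ^ 2 := by gcongr
      _ = _ := by field_simp
  have h4 : 2 * ((#E : ℝ) ^ 2 * q) * (#E ^ 2 / q ^ 2) = 2 * (#E ^ 4 / q) := by field_simp
  rw [h4]; linarith

/-- The `n`-th moment of the return count, by splitting it into its average and its deviation. -/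
lemma sum_returnCount_pow_le [IsLocalRing R] (E : Finset (Fin 2 → R)) {n : ℕ} (hn : 2 ≤ n) :
    ∑ g ∈ unimodularPairs R, (returnCount E g : ℝ) ^ n ≤
      2 ^ n * (Fintype.card R ^ 3 * (#E ^ 2 / Fintype.card R ^ 2) ^ n +
        #E ^ (n - 2) *
          ∑ g ∈ unimodularPairs R, ((returnCount E g : ℝ) - #E ^ 2 / Fintype.card R ^ 2) ^ 2) := by
  have hq : (0 : ℝ) < Fintype.card R := by exact_mod_cast Fintype.card_pos
  have h2 : (#(unimodularPairs R) : ℝ) ≤ Fintype.card R ^ 3 := by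
    exact_mod_cast card_unimodularPairs_le
  have hEq : (#E : ℝ) ≤ Fintype.card R ^ 2 := by
    have := Finset.card_le_univ E
    simp only [Fintype.card_pi_const] at this
    exact_mod_cast this
  set q : ℝ := (Fintype.card R : ℝ)
  set μ : ℝ := #E ^ 2 / q ^ 2 with hμ
  have hμ0 : 0 ≤ μ := by positivity
  have hμE : μ ≤ #E := by
    rw [hμ, div_le_iff₀ (by positivity), sq]
    gcongr
  -- All but two of the factors |r - μ| are bounded by |E|, which reduces the n-th moment to the
  -- second.
  have key : ∀ g, (returnCount E g : ℝ) ^ n ≤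
      2 ^ n * (μ ^ n + #E ^ (n - 2) * ((returnCount E g : ℝ) - μ) ^ 2) := by
    intro g
    set r : ℝ := (returnCount E g : ℝ)
    have hr0 : 0 ≤ r := by positivity
    have hrE : r ≤ #E := by
      exact Nat.cast_le.2 (Finset.card_filter_le _ _)
    have ha : r ≤ μ + |r - μ| := by linarith [le_abs_self (r - μ)]
    have hb : |r - μ| ≤ #E := by rw [abs_le]; constructor <;> linarith
    calc r ^ n ≤ (μ + |r - μ|) ^ n := by gcongr
      _ ≤ 2 ^ (n - 1) * (μ ^ n + |r - μ| ^ n) := add_pow_le hμ0 (abs_nonneg _) n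
      _ ≤ 2 ^ n * (μ ^ n + |r - μ| ^ (n - 2) * |r - μ| ^ 2) := by
          rw [← pow_add, Nat.sub_add_cancel hn]
          gcongr
          · norm_num
          · omega
      _ ≤ _ := by rw [sq_abs]; gcongr
  calc _ ≤ ∑ g ∈ unimodularPairs R,
        2 ^ n * (μ ^ n + #E ^ (n - 2) * ((returnCount E g : ℝ) - μ) ^ 2) :=
        Finset.sum_le_sum fun g _ => key g
    _ = 2 ^ n * (#(unimodularPairs R) * μ ^ n + #E ^ (n - 2) *
          ∑ g ∈ unimodularPairs R, ((returnCount E g : ℝ) - μ) ^ 2) := by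
        rw [← Finset.mul_sum, Finset.sum_add_distrib, ← Finset.mul_sum]; simp
    _ ≤ _ := by gcongr

end Moments

/-! ### The determinant energy by a variance argument -/

section Energy

variable {R : Type*} [CommRing R] [Fintype R] [DecidableEq R]

lemma wedgeEnergy_eq_sum_sq (E : Finset (Fin 2 → R)) :
    wedgeEnergy E = ∑ d : R, (∑ x ∈ E, #{z ∈ E | wedge x z = d}) ^ 2 := by
  simp only [sq, Finset.sum_mul_sum, Finset.card_filter, wedgeEnergy]
  symm
  rw [Finset.sum_comm]
  refine Finset.sum_congr rfl fun x _ => ?_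
  rw [Finset.sum_comm]
  refine Eq.trans ?_ (Finset.sum_comm (s := E) (t := E))
  refine Finset.sum_congr rfl fun y _ => ?_
  rw [Finset.sum_comm]
  refine Finset.sum_congr rfl fun x' _ => ?_
  rw [Finset.sum_comm]
  refine Finset.sum_congr rfl fun y' _ => ?_
  simp [eq_comm]

lemma sum_sum_card_wedge_sq (E : Finset (Fin 2 → R)) :
    ∑ x : Fin 2 → R, ∑ d : R, #{z ∈ E | wedge x z = d} ^ 2 =
      ∑ z ∈ E, ∑ z' ∈ E, #{x : Fin 2 → R | wedge x (z - z') = 0} := by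
  have h : ∀ x : Fin 2 → R, ∑ d : R, #{z ∈ E | wedge x z = d} ^ 2 =
      ∑ z ∈ E, ∑ z' ∈ E, if wedge x (z - z') = 0 then 1 else 0 := by
    intro x
    simp only [sq, Finset.sum_mul_sum, Finset.card_filter]
    rw [Finset.sum_comm]
    refine Finset.sum_congr rfl fun z _ => ?_
    rw [Finset.sum_comm]
    refine Finset.sum_congr rfl fun z' _ => ?_
    simp [wedge_sub_right, sub_eq_zero, eq_comm]
  rw [Finset.sum_congr rfl fun x _ => h x]
  simp only [Finset.card_filter]
  rw [Finset.sum_comm]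
  exact Finset.sum_congr rfl fun z _ => Finset.sum_comm (s := univ) (t := E)

/-- The energy exceeds its expected value by an amount controlled by the number of incidences
`x ∧ (z - z') = 0`, where `x` is allowed to range over the whole plane. -/
lemma wedgeEnergy_le [Nontrivial R] (E : Finset (Fin 2 → R)) :
    (wedgeEnergy E : ℝ) ≤ #E ^ 4 / Fintype.card R + #E *
      ((∑ z ∈ E, ∑ z' ∈ E, (#{x : Fin 2 → R | wedge x (z - z') = 0} : ℝ)) -
        Fintype.card R * #E ^ 2) := by
  have hq : (0 : ℝ) < (Fintype.card R : ℝ) := by exact_mod_cast Fintype.card_pos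
  have hen : (wedgeEnergy E : ℝ) = ∑ d : R, (∑ x ∈ E, (#{z ∈ E | wedge x z = d} : ℝ)) ^ 2 := by
    exact_mod_cast wedgeEnergy_eq_sum_sq E
  have hinc : ∑ x : Fin 2 → R, ∑ d : R, (#{z ∈ E | wedge x z = d} : ℝ) ^ 2 =
      ∑ z ∈ E, ∑ z' ∈ E, (#{x : Fin 2 → R | wedge x (z - z') = 0} : ℝ) := by
    exact_mod_cast sum_sum_card_wedge_sq E
  have hsum : ∀ x : Fin 2 → R, ∑ d : R, (#{z ∈ E | wedge x z = d} : ℝ) = #E := by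
    intro x
    exact_mod_cast (Finset.card_eq_sum_card_fiberwise (s := E) (t := (univ : Finset R))
      (f := fun z => wedge x z) (fun _ _ => by simp)).symm
  rw [hen, ← hinc]
  set a : (Fin 2 → R) → R → ℝ := fun x d => (#{z ∈ E | wedge x z = d} : ℝ)
  change ∀ x, ∑ d, a x d = #E at hsum
  change ∑ d, (∑ x ∈ E, a x d) ^ 2 ≤ #E ^ 4 / Fintype.card R + #E *
    ((∑ x, ∑ d, a x d ^ 2) - Fintype.card R * #E ^ 2)
  have hcard : ∑ _d : R, (1 : ℝ) = Fintype.card R := by simp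
  set q : ℝ := (Fintype.card R : ℝ)
  set e : ℝ := (#E : ℝ)
  have hvar : ∀ x, ∑ d, (a x d - e / q) ^ 2 = (∑ d, a x d ^ 2) - e ^ 2 / q := by
    intro x
    have h1 : ∀ d, (a x d - e / q) ^ 2 = a x d ^ 2 - 2 * (e / q) * a x d + (e / q) ^ 2 * 1 := by
      intro d; ring
    simp only [h1]
    rw [Finset.sum_add_distrib, Finset.sum_sub_distrib, ← Finset.mul_sum, ← Finset.mul_sum, hsum,
      hcard]
    field_simp; ring
  have hdev : ∀ d, ∑ x ∈ E, a x d = e ^ 2 / q + ∑ x ∈ E, (a x d - e / q) := by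
    intro d
    rw [Finset.sum_sub_distrib, Finset.sum_const, nsmul_eq_mul]
    change _ = e ^ 2 / q + (∑ x ∈ E, a x d - e * (e / q))
    ring
  have hdev0 : ∑ d, ∑ x ∈ E, (a x d - e / q) = 0 := by
    rw [Finset.sum_comm]
    refine Finset.sum_eq_zero fun x _ => ?_
    have h1 : ∀ d, a x d - e / q = a x d - (e / q) * 1 := by intro d; ring
    simp only [h1]
    rw [Finset.sum_sub_distrib, hsum, ← Finset.mul_sum, hcard]
    field_simp; ring
  have hexp : ∑ d, (∑ x ∈ E, a x d) ^ 2 = e ^ 4 / q + ∑ d, (∑ x ∈ E, (a x d - e / q)) ^ 2 := by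
    simp only [hdev]
    have h1 : ∀ d, (e ^ 2 / q + ∑ x ∈ E, (a x d - e / q)) ^ 2 = (e ^ 2 / q) ^ 2 * 1 +
        2 * (e ^ 2 / q) * ∑ x ∈ E, (a x d - e / q) + (∑ x ∈ E, (a x d - e / q)) ^ 2 := by
      intro d; ring
    simp only [h1]
    rw [Finset.sum_add_distrib, Finset.sum_add_distrib, ← Finset.mul_sum, ← Finset.mul_sum, hdev0,
      hcard]
    field_simp; ring
  rw [hexp]
  gcongr
  -- Cauchy–Schwarz over x ∈ E; by positivity x may then range over the whole plane, where the sum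
  -- is an incidence count.
  calc ∑ d, (∑ x ∈ E, (a x d - e / q)) ^ 2 ≤ ∑ d, e * ∑ x ∈ E, (a x d - e / q) ^ 2 :=
        Finset.sum_le_sum fun d _ => sq_sum_le_card_mul_sum_sq
    _ = e * ∑ x ∈ E, ∑ d, (a x d - e / q) ^ 2 := by rw [← Finset.mul_sum, Finset.sum_comm]
    _ ≤ e * ∑ x, ∑ d, (a x d - e / q) ^ 2 := by
        refine mul_le_mul_of_nonneg_left ?_ (Nat.cast_nonneg _)
        refine Finset.sum_le_sum_of_subset_of_nonneg (Finset.subset_univ E) fun x _ _ => ?_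
        exact Finset.sum_nonneg fun d _ => sq_nonneg _
    _ = _ := by
        simp only [hvar]
        rw [Finset.sum_sub_distrib]
        congr 2
        simp only [sum_const, card_univ, Fintype.card_pi_const, nsmul_eq_mul]
        push_cast
        change q ^ 2 * (e ^ 2 / q) = _
        field_simp

end Energy

/-! ### Divisibility and incidences modulo a prime power -/

section PrimePower

variable {p ℓ : ℕ}

lemma pow_dvd_intCast_iff {m : ℕ} (hm : m ≤ ℓ) (z : ℤ) :
    (p : ZMod (p ^ ℓ)) ^ m ∣ (z : ZMod (p ^ ℓ)) ↔ (p : ℤ) ^ m ∣ z := by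
  constructor
  · rintro ⟨c, hc⟩
    obtain ⟨c, rfl⟩ := ZMod.intCast_surjective c
    have h : ((z - p ^ m * c : ℤ) : ZMod (p ^ ℓ)) = 0 := by push_cast; rw [hc, sub_self]
    rw [ZMod.intCast_zmod_eq_zero_iff_dvd] at h
    have h' : (p : ℤ) ^ m ∣ z - p ^ m * c :=
      (pow_dvd_pow _ hm).trans (by exact_mod_cast h)
    exact (dvd_sub_left (dvd_mul_right _ _)).1 h'
  · rintro ⟨c, rfl⟩
    exact ⟨c, by push_cast; rfl⟩

variable [Fact p.Prime]

lemma isUnit_iff_not_dvd (hℓ : 0 < ℓ) (a : ZMod (p ^ ℓ)) :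
    IsUnit a ↔ ¬ (p : ZMod (p ^ ℓ)) ∣ a := by
  have h := pow_dvd_intCast_iff (p := p) (ℓ := ℓ) (m := 1) hℓ (a.val : ℤ)
  have h' := ZMod.isUnit_natCast_iff_not_dvd_pow (a := a.val) (Fact.out : p.Prime) hℓ
  simp only [pow_one, Int.cast_natCast, ZMod.natCast_zmod_val, Int.natCast_dvd_natCast] at h h'
  rw [h', h]

lemma isLocalRing_zmod_pow (hℓ : 0 < ℓ) : IsLocalRing (ZMod (p ^ ℓ)) := by
  have : Fact (1 < p ^ ℓ) := ⟨Nat.one_lt_pow hℓ.ne' (Fact.out : p.Prime).one_lt⟩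
  refine IsLocalRing.of_nonunits_add fun a b ha hb => ?_
  simp only [mem_nonunits_iff, isUnit_iff_not_dvd hℓ, not_not] at *
  exact dvd_add ha hb

lemma card_pow_mul_eq_zero_le (m : ℕ) :
    #{c : ZMod (p ^ ℓ) | (p : ZMod (p ^ ℓ)) ^ m * c = 0} ≤ p ^ m := by
  have := IsAddCyclic.card_nsmul_eq_zero_le (α := ZMod (p ^ ℓ)) (n := p ^ m)
    (pow_pos (Fact.out : p.Prime).pos m)
  simpa using this

lemma card_pow_dvd_le {m : ℕ} (hm : m ≤ ℓ) :
    #{c : ZMod (p ^ ℓ) | (p : ZMod (p ^ ℓ)) ^ m ∣ c} ≤ p ^ (ℓ - m) := by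
  refine le_trans (Finset.card_le_card ?_) (card_pow_mul_eq_zero_le (ℓ - m))
  intro c hc
  simp only [Finset.mem_filter, mem_univ, true_and] at hc ⊢
  obtain ⟨d, rfl⟩ := hc
  rw [← mul_assoc, ← pow_add, Nat.sub_add_cancel hm]
  have : (p : ZMod (p ^ ℓ)) ^ ℓ = 0 := by exact_mod_cast ZMod.natCast_self (p ^ ℓ)
  rw [this, zero_mul]

lemma card_not_isUnit_le (hℓ : 0 < ℓ) [DecidablePred (IsUnit (M := ZMod (p ^ ℓ)))] :
    #{c : ZMod (p ^ ℓ) | ¬ IsUnit c} ≤ p ^ (ℓ - 1) := by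
  have := card_pow_dvd_le (p := p) (ℓ := ℓ) (m := 1) hℓ
  simpa only [isUnit_iff_not_dvd hℓ, not_not, pow_one] using this

lemma card_forall_pow_dvd_le {m : ℕ} (hm : m ≤ ℓ) :
    #{w : Fin 2 → ZMod (p ^ ℓ) | ∀ i, (p : ZMod (p ^ ℓ)) ^ m ∣ w i} ≤ (p ^ (ℓ - m)) ^ 2 := by
  have h : ({w : Fin 2 → ZMod (p ^ ℓ) | ∀ i, (p : ZMod (p ^ ℓ)) ^ m ∣ w i} : Finset _) =
      Fintype.piFinset fun _ => {c : ZMod (p ^ ℓ) | (p : ZMod (p ^ ℓ)) ^ m ∣ c} := by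
    ext; simp
  rw [h, Fintype.card_piFinset]
  simp only [prod_const, card_univ, Fintype.card_fin]
  gcongr
  exact card_pow_dvd_le hm

lemma card_not_isPrimitiveVec_le (hℓ : 0 < ℓ)
    [DecidablePred (IsPrimitiveVec (R := ZMod (p ^ ℓ)))] :
    #{w : Fin 2 → ZMod (p ^ ℓ) | ¬ IsPrimitiveVec w} ≤ (p ^ (ℓ - 1)) ^ 2 := by
  have := card_forall_pow_dvd_le (p := p) (ℓ := ℓ) (m := 1) hℓ
  simpa only [IsPrimitiveVec, isUnit_iff_not_dvd hℓ, not_or, not_not, pow_one,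
    Fin.forall_fin_two] using this

/-- Every vector is a power of `p` times a primitive vector. -/
lemma exists_pow_smul_isPrimitiveVec (hℓ : 0 < ℓ) (w : Fin 2 → ZMod (p ^ ℓ)) :
    ∃ m ≤ ℓ, ∃ v, IsPrimitiveVec v ∧ w = (p : ZMod (p ^ ℓ)) ^ m • v := by
  classical
  set P : ℕ → Prop := fun m => ∃ v : Fin 2 → ZMod (p ^ ℓ), w = (p : ZMod (p ^ ℓ)) ^ m • v
  have h0 : P 0 := ⟨w, by simp⟩
  obtain ⟨v, hv⟩ : P (Nat.findGreatest P ℓ) := Nat.findGreatest_spec (Nat.zero_le ℓ) h0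
  rcases (Nat.findGreatest_le (P := P) ℓ).eq_or_lt with h | h
  · refine ⟨ℓ, le_rfl, ![1, 0], Or.inl (by simp), ?_⟩
    have : (p : ZMod (p ^ ℓ)) ^ ℓ = 0 := by exact_mod_cast ZMod.natCast_self (p ^ ℓ)
    rw [hv, h, this, zero_smul, zero_smul]
  · refine ⟨_, h.le, v, ?_, hv⟩
    by_contra hp
    simp only [IsPrimitiveVec, isUnit_iff_not_dvd hℓ, not_or, not_not] at hp
    obtain ⟨⟨a, ha⟩, ⟨b, hb⟩⟩ := hp
    refine Nat.findGreatest_is_greatest (P := P) (Nat.lt_succ_self _) h ⟨![a, b], ?_⟩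
    refine hv.trans ?_
    rw [pow_succ, mul_smul]
    congr 1
    ext i; fin_cases i <;> simp [ha, hb]

/-- For w = p^m v with v primitive, p^m must kill x ∧ v: at most p^m values, each taken p^ℓ times.
Writing p^m as one term of a sum over divisibility conditions makes the bound easy to sum over w. -/
lemma card_wedge_eq_zero_le (hℓ : 0 < ℓ) (w : Fin 2 → ZMod (p ^ ℓ)) :
    #{x : Fin 2 → ZMod (p ^ ℓ) | wedge x w = 0} ≤ p ^ ℓ + p ^ ℓ *
      ∑ m ∈ Finset.Icc 1 ℓ, if ∀ i, (p : ZMod (p ^ ℓ)) ^ m ∣ w i then p ^ m else 0 := by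
  obtain ⟨m, hm, v, hv, rfl⟩ := exists_pow_smul_isPrimitiveVec hℓ w
  have h1 : #{x : Fin 2 → ZMod (p ^ ℓ) | wedge x ((p : ZMod (p ^ ℓ)) ^ m • v) = 0} ≤
      p ^ ℓ * p ^ m := by
    rw [Finset.card_eq_sum_card_fiberwise (f := fun x => wedge v x)
      (t := {c : ZMod (p ^ ℓ) | (p : ZMod (p ^ ℓ)) ^ m * c = 0})]
    · calc _ ≤ ∑ c ∈ {c : ZMod (p ^ ℓ) | (p : ZMod (p ^ ℓ)) ^ m * c = 0}, p ^ ℓ := by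
            refine Finset.sum_le_sum fun c _ => ?_
            rw [Finset.filter_filter]
            refine (Finset.card_le_card (Finset.monotone_filter_right _ fun x _ h => h.2)).trans ?_
            rw [card_wedge_eq hv c, ZMod.card]
        _ ≤ _ := by
            rw [Finset.sum_const, smul_eq_mul, mul_comm]
            gcongr
            exact card_pow_mul_eq_zero_le m
    · intro x hx
      have hx := (Finset.mem_filter.1 hx).2
      simp only [coe_filter, mem_univ, true_and, Set.mem_ofPred_eq]
      rw [wedge_smul_right, wedge_swap, mul_neg, neg_eq_zero] at hx
      exact hx
  refine h1.trans ?_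
  rcases Nat.eq_zero_or_pos m with rfl | hm0
  · simp
  · refine le_trans ?_ (Nat.le_add_left _ _)
    gcongr
    have h2 := Finset.single_le_sum (f := fun m' => if ∀ i, (p : ZMod (p ^ ℓ)) ^ m' ∣
      ((p : ZMod (p ^ ℓ)) ^ m • v) i then p ^ m' else 0) (fun _ _ => Nat.zero_le _)
      (Finset.mem_Icc.2 ⟨hm0, hm⟩)
    rwa [if_pos (fun i => by simp)] at h2

/-- For fixed z and m, at most p^(2(ℓ-m)) points z' satisfy p^m ∣ z - z'; with weight p^m this is
p^(2ℓ-m) ≤ p^(2ℓ-1). The factor ℓ counts the values of m. -/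
lemma sum_card_wedge_eq_zero_le (hℓ : 0 < ℓ) (E : Finset (Fin 2 → ZMod (p ^ ℓ))) :
    ∑ z ∈ E, ∑ z' ∈ E, #{x : Fin 2 → ZMod (p ^ ℓ) | wedge x (z - z') = 0} ≤
      p ^ ℓ * #E ^ 2 + #E * (p ^ ℓ * (ℓ * p ^ (2 * ℓ - 1))) := by
  have h : ∀ z ∈ E, ∑ z' ∈ E, #{x : Fin 2 → ZMod (p ^ ℓ) | wedge x (z - z') = 0} ≤
      p ^ ℓ * #E + p ^ ℓ * (ℓ * p ^ (2 * ℓ - 1)) := by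
    intro z _
    refine (Finset.sum_le_sum fun z' _ => card_wedge_eq_zero_le hℓ (z - z')).trans ?_
    rw [Finset.sum_add_distrib, Finset.sum_const, smul_eq_mul, ← Finset.mul_sum, mul_comm #E]
    gcongr
    rw [Finset.sum_comm]
    calc _ ≤ ∑ m ∈ Finset.Icc 1 ℓ, p ^ (2 * ℓ - 1) := by
          refine Finset.sum_le_sum fun m hm => ?_
          rw [Finset.mem_Icc] at hm
          calc _ ≤ ∑ w : Fin 2 → ZMod (p ^ ℓ),
                  if ∀ i, (p : ZMod (p ^ ℓ)) ^ m ∣ w i then p ^ m else 0 := by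
                rw [← Equiv.sum_comp (Equiv.subLeft z)]
                exact Finset.sum_le_univ_sum_of_nonneg fun _ => Nat.zero_le _
            _ ≤ (p ^ (ℓ - m)) ^ 2 * p ^ m := by
                rw [← Finset.sum_filter, Finset.sum_const, smul_eq_mul]
                gcongr
                exact card_forall_pow_dvd_le hm.2
            _ = p ^ (2 * ℓ - m) := by
                rw [← pow_mul, ← pow_add]; congr 1; omega
            _ ≤ _ := Nat.pow_le_pow_right (Fact.out : p.Prime).pos (by omega)
      _ = _ := by simp
  refine (Finset.sum_le_sum h).trans (le_of_eq ?_)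
  rw [Finset.sum_const, smul_eq_mul]; ring

end PrimePower

/-! ### Classes as matrices of wedges, and Cauchy–Schwarz -/

section Gram

variable {R : Type*} [CommRing R]

/-- The matrix of pairwise wedges of a configuration. -/
def gram {n : ℕ} (x : Fin n → Fin 2 → R) : Fin n → Fin n → R := fun i j => wedge (x i) (x j)

lemma natCard_configClasses (n : ℕ) (E : Set (Fin 2 → R)) :
    Nat.card (ConfigClasses n E) = (gram '' {x : Fin n → Fin 2 → R | ∀ i, x i ∈ E}).ncard := by
  set f : ConfigClasses n E → (Fin n → Fin n → R) :=
    Quotient.lift (fun x => gram fun i => (x i : Fin 2 → R)) (by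
      intro x y h
      ext i j
      have := h i j
      rwa [dotProduct_perp, dotProduct_perp] at this) with hf
  have hinj : Function.Injective f := by
    rintro ⟨x⟩ ⟨y⟩ h
    refine Quotient.sound fun i j => ?_
    rw [dotProduct_perp, dotProduct_perp]
    exact congrFun (congrFun h i) j
  have hrange : Set.range f = gram '' {x : Fin n → Fin 2 → R | ∀ i, x i ∈ E} := by
    ext M
    constructor
    · rintro ⟨⟨x⟩, rfl⟩
      exact ⟨fun i => (x i : Fin 2 → R), fun i => (x i).2, rfl⟩
    · rintro ⟨x, hx, rfl⟩
      exact ⟨Quotient.mk _ fun i => ⟨x i, hx i⟩, rfl⟩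
  rw [← hrange, ← Nat.card_coe_set_eq, Nat.card_range_of_injective hinj]

variable [Fintype R] [DecidableEq R]

lemma card_sq_le_card_image_mul {α β : Type*} [DecidableEq β] (T : Finset α) (f : α → β) :
    #T ^ 2 ≤ #(T.image f) * #{a ∈ T ×ˢ T | f a.1 = f a.2} := by
  have h : #{a ∈ T ×ˢ T | f a.1 = f a.2} = ∑ b ∈ T.image f, #{a ∈ T | f a = b} ^ 2 := by
    rw [Finset.card_eq_sum_card_fiberwise (f := fun a => f a.1) (t := T.image f)]
    · refine Finset.sum_congr rfl fun b _ => ?_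
      rw [sq, ← Finset.card_product]
      congr 1
      ext ⟨x, y⟩
      simp only [Finset.mem_filter, Finset.mem_product]
      constructor
      · rintro ⟨⟨⟨hx, hy⟩, h⟩, h'⟩; exact ⟨⟨hx, h'⟩, hy, h.symm.trans h'⟩
      · rintro ⟨⟨hx, h⟩, hy, h'⟩; exact ⟨⟨⟨hx, hy⟩, h.trans h'.symm⟩, h⟩
    · intro a ha
      exact Finset.mem_coe.2 (Finset.mem_image_of_mem _
        (Finset.mem_product.1 (Finset.mem_filter.1 ha).1).1)
  rw [h, Finset.card_eq_sum_card_image f T]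
  exact sq_sum_le_card_mul_sum_sq

/-- The configurations in `E` whose first two points span the plane. -/
def spanningConfigs [DecidablePred (IsUnit (M := R))] (m : ℕ) (E : Finset (Fin 2 → R)) :
    Finset (Fin (m + 2) → Fin 2 → R) :=
  {x ∈ Fintype.piFinset fun _ => E | IsUnit (wedge (x 0) (x 1))}

variable [DecidablePred (IsUnit (M := R))]

/-- A pair with equal matrices is recovered from its first member and the connecting g, and g must
return every point of that member to E. -/
lemma card_gram_eq_gram_le (m : ℕ) (E : Finset (Fin 2 → R)) :
    #{a ∈ spanningConfigs m E ×ˢ spanningConfigs m E | gram a.1 = gram a.2} ≤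
      ∑ g ∈ unimodularPairs R, returnCount E g ^ (m + 2) := by
  have h1 : ∀ g ∈ unimodularPairs R, returnCount E g ^ (m + 2) =
      #(Fintype.piFinset fun _ : Fin (m + 2) => {x ∈ E | act g x ∈ E}) := by
    intro g _
    rw [Fintype.card_piFinset]
    simp [returnCount]
  have h2 : ∀ a ∈ ({a ∈ spanningConfigs m E ×ˢ spanningConfigs m E | gram a.1 = gram a.2} :
      Finset _), ∃ g : (Fin 2 → R) × (Fin 2 → R), wedge g.1 g.2 = 1 ∧
        ∀ i, act g (a.1 i) = a.2 i := by
    intro a ha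
    simp only [Finset.mem_filter, Finset.mem_product, spanningConfigs] at ha
    exact exists_act_eq (fun i j => congrFun (congrFun ha.2 i) j) ha.1.1.2
  choose! G hG1 hG2 using h2
  rw [Finset.sum_congr rfl h1, ← Finset.card_sigma]
  refine Finset.card_le_card_of_injOn (fun a => ⟨G a, a.1⟩) ?_ ?_
  · intro a ha
    have h := hG2 a ha
    have h' := hG1 a ha
    have hT := Finset.mem_product.1 (Finset.mem_filter.1 ha).1
    simp only [spanningConfigs, Finset.mem_filter, Fintype.mem_piFinset] at hT
    simp only [coe_sigma, Set.mem_sigma_iff, mem_coe, Finset.mem_filter, Fintype.mem_piFinset,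
      mem_unimodularPairs]
    exact ⟨h', fun i => ⟨hT.1.1 i, by rw [h i]; exact hT.2.1 i⟩⟩
  · intro a ha b hb e
    simp only [Sigma.mk.injEq, heq_eq_eq] at e
    refine Prod.ext e.2 (funext fun i => ?_)
    rw [← hG2 a ha i, ← hG2 b hb i, e.1, e.2]

/-- In a non-spanning configuration, point 0 lies in the small set of vectors with non-unit wedge
against point 1; the other points are free. -/
lemma card_pow_le_card_spanningConfigs (m : ℕ) {E : Finset (Fin 2 → R)}
    (hE : ∀ x ∈ E, IsPrimitiveVec x) :
    #E ^ (m + 2) ≤ #(spanningConfigs m E) +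
      #E ^ (m + 1) * (#{c : R | ¬ IsUnit c} * Fintype.card R) := by
  have h1 : #E ^ (m + 2) = #(Fintype.piFinset fun _ : Fin (m + 2) => E) := by
    rw [Fintype.card_piFinset]; simp
  rw [h1, ← Finset.card_filter_add_card_filter_not (fun x => IsUnit (wedge (x 0) (x 1)))]
  refine Nat.add_le_add_left ?_ _
  have h2 : #E ^ (m + 1) * (#{c : R | ¬ IsUnit c} * Fintype.card R) =
      #((Fintype.piFinset fun _ : Fin (m + 1) => E).sigma fun t =>
        {v : Fin 2 → R | ¬ IsUnit (wedge (t 0) v)}) := by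
    rw [Finset.card_sigma, Finset.sum_congr rfl fun t ht =>
      card_wedge_not_isUnit (hE _ (Fintype.mem_piFinset.1 ht 0)), Finset.sum_const,
      Fintype.card_piFinset]
    simp
  rw [h2]
  refine Finset.card_le_card_of_injOn (fun x => ⟨fun i => x i.succ, x 0⟩) ?_ ?_
  · intro x hx
    have hx := Finset.mem_filter.1 hx
    rw [Fintype.mem_piFinset] at hx
    simp only [coe_sigma, Set.mem_sigma_iff, mem_coe, Finset.mem_filter, Fintype.mem_piFinset,
      mem_univ, true_and]
    refine ⟨fun i => hx.1 _, ?_⟩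
    rw [wedge_swap, IsUnit.neg_iff]
    exact hx.2
  · intro x _ y _ e
    simp only [Sigma.mk.injEq, heq_eq_eq] at e
    funext i
    refine Fin.cases e.2 (fun j => congrFun e.1 j) i

end Gram

/-! ### Lower bound for the classes of a set of primitive vectors -/

section LowerBound

variable {p ℓ : ℕ} [Fact p.Prime]

lemma wedgeEnergy_zmod_le (hℓ : 0 < ℓ) (E : Finset (Fin 2 → ZMod (p ^ ℓ))) :
    (wedgeEnergy E : ℝ) ≤ #E ^ 4 / (p : ℝ) ^ ℓ + #E ^ 2 * (ℓ * ((p : ℝ) ^ ℓ) ^ 3 / p) := by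
  have hp : (0 : ℝ) < p := by exact_mod_cast (Fact.out : p.Prime).pos
  have := isLocalRing_zmod_pow (p := p) hℓ
  have h := wedgeEnergy_le E
  have h1 : ((∑ z ∈ E, ∑ z' ∈ E, #{x : Fin 2 → ZMod (p ^ ℓ) | wedge x (z - z') = 0} : ℕ) : ℝ) ≤
      ((p ^ ℓ * #E ^ 2 + #E * (p ^ ℓ * (ℓ * p ^ (2 * ℓ - 1))) : ℕ) : ℝ) :=
    Nat.cast_le.2 (sum_card_wedge_eq_zero_le hℓ E)
  push_cast at h1
  rw [ZMod.card] at h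
  push_cast at h
  have h2 : (p : ℝ) ^ (2 * ℓ - 1) = ((p : ℝ) ^ ℓ) ^ 2 / p := by
    rw [eq_div_iff hp.ne', ← pow_succ, ← pow_mul]; congr 1; omega
  rw [h2] at h1
  refine h.trans ?_
  have h3 : (#E : ℝ) * ((∑ z ∈ E, ∑ z' ∈ E, (#{x : Fin 2 → ZMod (p ^ ℓ) |
      wedge x (z - z') = 0} : ℝ)) - (p : ℝ) ^ ℓ * #E ^ 2) ≤
      #E * (#E * ((p : ℝ) ^ ℓ * (ℓ * (((p : ℝ) ^ ℓ) ^ 2 / p)))) := by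
    refine mul_le_mul_of_nonneg_left ?_ (Nat.cast_nonneg _)
    linarith
  have h4 : (#E : ℝ) * (#E * ((p : ℝ) ^ ℓ * (ℓ * (((p : ℝ) ^ ℓ) ^ 2 / p)))) =
    #E ^ 2 * (ℓ * ((p : ℝ) ^ ℓ) ^ 3 / p) := by ring
  linarith

lemma sum_returnCount_sub_sq_zmod_le (hℓ : 0 < ℓ) {E : Finset (Fin 2 → ZMod (p ^ ℓ))}
    (hE : ∀ x ∈ E, IsPrimitiveVec x) :
    ∑ g ∈ unimodularPairs (ZMod (p ^ ℓ)),
      ((returnCount E g : ℝ) - #E ^ 2 / ((p : ℝ) ^ ℓ) ^ 2) ^ 2 ≤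
        #E ^ 2 * (2 * ℓ * ((p : ℝ) ^ ℓ) ^ 3 / p) := by
  classical
  have hp : (0 : ℝ) < p := by exact_mod_cast (Fact.out : p.Prime).pos
  have := isLocalRing_zmod_pow (p := p) hℓ
  have h1 := sum_returnCount_sub_sq_le hE
  have h2 : ((∑ g ∈ unimodularPairs (ZMod (p ^ ℓ)), returnCount E g ^ 2 : ℕ) : ℝ) ≤
      ((wedgeEnergy E + #E ^ 2 * (p ^ (ℓ - 1) * (p ^ ℓ) ^ 2) : ℕ) : ℝ) := by
    refine Nat.cast_le.2 ((sum_returnCount_sq_le hE).trans ?_)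
    rw [ZMod.card]
    gcongr
    exact card_not_isUnit_le hℓ
  have h3 := wedgeEnergy_zmod_le hℓ E
  rw [ZMod.card] at h1
  push_cast at h1 h2
  have h4 : (p : ℝ) ^ (ℓ - 1) = (p : ℝ) ^ ℓ / p := by
    rw [eq_div_iff hp.ne', ← pow_succ]; congr 1; omega
  rw [h4] at h2
  have h5 : (#E : ℝ) ^ 2 * ((p : ℝ) ^ ℓ / p * ((p : ℝ) ^ ℓ) ^ 2) ≤
      #E ^ 2 * (ℓ * ((p : ℝ) ^ ℓ) ^ 3 / p) := by
    have hl : (1 : ℝ) ≤ ℓ := by exact_mod_cast hℓ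
    have : (p : ℝ) ^ ℓ / p * ((p : ℝ) ^ ℓ) ^ 2 = 1 * ((p : ℝ) ^ ℓ) ^ 3 / p := by ring
    rw [this]; gcongr
  have h6 : (#E : ℝ) ^ 2 * (2 * ℓ * ((p : ℝ) ^ ℓ) ^ 3 / p) =
    #E ^ 2 * (ℓ * ((p : ℝ) ^ ℓ) ^ 3 / p) + #E ^ 2 * (ℓ * ((p : ℝ) ^ ℓ) ^ 3 / p) := by ring
  linarith

/-- A large set of primitive vectors determines a positive proportion of all classes. -/
lemma pow_le_card_image_gram (hℓ : 0 < ℓ) [DecidablePred (IsUnit (M := ZMod (p ^ ℓ)))] (m : ℕ)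
    {E : Finset (Fin 2 → ZMod (p ^ ℓ))}
    (hE : ∀ x ∈ E, IsPrimitiveVec x) {A : ℝ} (hA : 0 < A)
    (h1 : 2 * ((p : ℝ) ^ ℓ) ^ 2 ≤ p * #E)
    (h2 : A * ℓ * ((p : ℝ) ^ ℓ) ^ (2 * (m + 2)) ≤ p * #E ^ (m + 2)) :
    ((p : ℝ) ^ ℓ) ^ (2 * m + 1) ≤
      4 * 2 ^ (m + 2) * (1 + 2 / A) * #((spanningConfigs m E).image gram) := by
  have hp : (0 : ℝ) < p := by exact_mod_cast (Fact.out : p.Prime).pos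
  have := isLocalRing_zmod_pow (p := p) hℓ
  have hcs := (card_sq_le_card_image_mul (spanningConfigs m E) gram).trans
    (Nat.mul_le_mul_left _ (card_gram_eq_gram_le m E))
  have hT := card_pow_le_card_spanningConfigs m hE
  have hB := card_not_isUnit_le (p := p) hℓ
  have hmom := sum_returnCount_pow_le E (n := m + 2) (by omega)
  have hdev := sum_returnCount_sub_sq_zmod_le hℓ hE
  rw [ZMod.card] at hT hmom
  push_cast at hmom
  have h4 : (p : ℝ) ^ (ℓ - 1) = (p : ℝ) ^ ℓ / p := by
    rw [eq_div_iff hp.ne', ← pow_succ]; congr 1; omega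
  have hB' : (#{c : ZMod (p ^ ℓ) | ¬ IsUnit c} : ℝ) ≤ (p : ℝ) ^ ℓ / p := by
    rw [← h4]; exact_mod_cast hB
  have hT' : (#E : ℝ) ^ (m + 2) ≤ #(spanningConfigs m E) +
      #E ^ (m + 1) * (#{c : ZMod (p ^ ℓ) | ¬ IsUnit c} * (p : ℝ) ^ ℓ) := by exact_mod_cast hT
  have hcs' : (#(spanningConfigs m E) : ℝ) ^ 2 ≤ #((spanningConfigs m E).image gram) *
      ∑ g ∈ unimodularPairs (ZMod (p ^ ℓ)), (returnCount E g : ℝ) ^ (m + 2) := by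
    exact_mod_cast hcs
  set T : ℝ := (#(spanningConfigs m E) : ℝ)
  set N : ℝ := (#((spanningConfigs m E).image gram) : ℝ)
  set e : ℝ := (#E : ℝ)
  have hq : (0 : ℝ) < (p : ℝ) ^ ℓ := by positivity
  set q : ℝ := (p : ℝ) ^ ℓ
  have he : 0 < e := by
    have : 0 < p * e := lt_of_lt_of_le (by positivity) h1
    exact pos_of_mul_pos_right this hp.le
  have hN : 0 ≤ N := Nat.cast_nonneg _
  -- By `h1` at most half of the configurations fail to span.
  have hTlow : e ^ (m + 2) / 2 ≤ T := by
    have : e ^ (m + 1) * (#{c : ZMod (p ^ ℓ) | ¬ IsUnit c} * q) ≤ e ^ (m + 1) * (e / 2) := by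
      gcongr
      calc _ ≤ q / p * q := by gcongr
        _ ≤ e / 2 := by
          rw [div_mul_eq_mul_div, div_le_div_iff₀ hp two_pos]; linarith
    have h5 : e ^ (m + 1) * (e / 2) = e ^ (m + 2) / 2 := by ring
    linarith
  -- By `h2` the deviation term is at most 2/A times the main term.
  have hsum : ∑ g ∈ unimodularPairs (ZMod (p ^ ℓ)), (returnCount E g : ℝ) ^ (m + 2) ≤
      2 ^ (m + 2) * ((1 + 2 / A) * (e ^ (2 * (m + 2)) / q ^ (2 * m + 1))) := by
    refine hmom.trans ?_
    gcongr
    rw [add_mul, one_mul]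
    refine add_le_add (le_of_eq ?_) ?_
    · rw [div_pow, ← pow_mul, ← pow_mul]
      field_simp
      ring
    · calc _ ≤ e ^ m * (e ^ 2 * (2 * ℓ * q ^ 3 / p)) := by gcongr
        _ = 2 / A * (e ^ (m + 2) * (A * ℓ * q ^ (2 * (m + 2))) / (p * q ^ (2 * m + 1))) := by
            field_simp
            ring
        _ ≤ 2 / A * (e ^ (m + 2) * (p * e ^ (m + 2)) / (p * q ^ (2 * m + 1))) := by gcongr
        _ = _ := by
            field_simp
            ring
  have hfin : (e ^ (m + 2) / 2) ^ 2 ≤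
      N * (2 ^ (m + 2) * ((1 + 2 / A) * (e ^ (2 * (m + 2)) / q ^ (2 * m + 1)))) :=
    calc _ ≤ T ^ 2 := by gcongr
      _ ≤ _ := hcs'
      _ ≤ _ := by gcongr
  have hpos : 0 < 4 * q ^ (2 * m + 1) / e ^ (2 * (m + 2)) := by positivity
  have := mul_le_mul_of_nonneg_right hfin hpos.le
  calc q ^ (2 * m + 1) = (e ^ (m + 2) / 2) ^ 2 * (4 * q ^ (2 * m + 1) / e ^ (2 * (m + 2))) := by
        field_simp
        ring
    _ ≤ _ := this
    _ = _ := by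
        field_simp

end LowerBound

/-! ### Upper bound for the classes of the whole plane -/

section UpperBound

variable {p ℓ : ℕ} [Fact p.Prime]

/-- By the Plücker relation, the wedges with two fixed points determine all other wedges, provided
that the wedge of the two fixed points has the least `p`-adic valuation. -/
lemma gram_eq_of_eq {n t : ℕ} (ht : t ≤ ℓ) {x x' : Fin n → Fin 2 → ZMod (p ^ ℓ)}
    (hx : ∀ a b, (p : ZMod (p ^ ℓ)) ^ t ∣ gram x a b)
    (hx' : ∀ a b, (p : ZMod (p ^ ℓ)) ^ t ∣ gram x' a b) {i j : Fin n}
    (hij : t = ℓ ∨ ¬ (p : ZMod (p ^ ℓ)) ^ (t + 1) ∣ gram x i j)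
    (hi : ∀ a, gram x i a = gram x' i a) (hj : ∀ a, gram x j a = gram x' j a) :
    gram x = gram x' := by
  have hpp : Prime (p : ℤ) := Nat.prime_iff_prime_int.1 Fact.out
  have hp0 : (p : ℤ) ^ t ≠ 0 := pow_ne_zero _ hpp.ne_zero
  rcases ht.eq_or_lt with rfl | htl
  · have h0 : (p : ZMod (p ^ t)) ^ t = 0 := by exact_mod_cast ZMod.natCast_self (p ^ t)
    simp only [h0, zero_dvd_iff] at hx hx'
    ext a b; rw [hx, hx']
  -- Dividing the Plücker relation by p^(2t) requires lifting to ℤ, where p is not a zero divisor.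
  have lift : ∀ y : Fin n → Fin 2 → ZMod (p ^ ℓ),
      (∀ a b, (p : ZMod (p ^ ℓ)) ^ t ∣ gram y a b) → ∃ w : Fin n → Fin n → ℤ,
        (∀ a b, gram y a b = ((p ^ t * w a b : ℤ) : ZMod (p ^ ℓ))) ∧
        ∀ a b c d, w a b * w c d = w a c * w b d - w a d * w b c := by
    intro y hy
    set Y : Fin n → Fin 2 → ℤ := fun a c => ((y a c).val : ℤ)
    have hY : ∀ a b, gram y a b = (wedge (Y a) (Y b) : ℤ) := by
      intro a b; simp [gram, wedge, Y]
    have hd : ∀ a b, (p : ℤ) ^ t ∣ wedge (Y a) (Y b) := by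
      intro a b
      rw [← pow_dvd_intCast_iff ht, ← hY]
      exact hy a b
    choose w hw using hd
    refine ⟨w, fun a b => by rw [hY, hw], fun a b c d => ?_⟩
    have := wedge_plucker (Y a) (Y b) (Y c) (Y d)
    simp only [hw] at this
    refine mul_left_cancel₀ (mul_ne_zero hp0 hp0) ?_
    linear_combination this
  obtain ⟨w, hw, hwp⟩ := lift x hx
  obtain ⟨w', hw', hwp'⟩ := lift x' hx'
  have hsplit : (p : ℤ) ^ ℓ = p ^ t * p ^ (ℓ - t) := by rw [← pow_add]; congr 1; omega
  have hiff : ∀ a b, gram x a b = gram x' a b ↔ w a b ≡ w' a b [ZMOD p ^ (ℓ - t)] := by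
    intro a b
    rw [hw, hw', ZMod.intCast_eq_intCast_iff, Int.modEq_iff_dvd, Int.modEq_iff_dvd, ← mul_sub]
    push_cast
    rw [hsplit, mul_dvd_mul_iff_left hp0]
  have hcop : IsCoprime ((p : ℤ) ^ (ℓ - t)) (w i j) := by
    refine IsCoprime.pow_left ((Prime.coprime_iff_not_dvd hpp).2 fun hdvd => ?_)
    rcases hij with h | h
    · omega
    · rw [hw, pow_dvd_intCast_iff htl, pow_succ] at h
      exact h (mul_dvd_mul_left _ hdvd)
  ext a b
  rw [hiff]
  have h1 : w i j * w a b ≡ w i j * w' a b [ZMOD p ^ (ℓ - t)] :=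
    calc w i j * w a b = w i a * w j b - w i b * w j a := hwp i j a b
      _ ≡ w' i a * w' j b - w' i b * w' j a [ZMOD p ^ (ℓ - t)] :=
          (((hiff _ _).1 (hi a)).mul ((hiff _ _).1 (hj b))).sub
            (((hiff _ _).1 (hi b)).mul ((hiff _ _).1 (hj a)))
      _ = w' i j * w' a b := (hwp' i j a b).symm
      _ ≡ w i j * w' a b [ZMOD p ^ (ℓ - t)] := ((hiff _ _).1 (hi j)).symm.mul_right _
  rw [Int.modEq_iff_dvd, ← mul_sub] at h1
  exact Int.modEq_iff_dvd.2 (hcop.dvd_of_dvd_mul_left h1)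

/-- Rows i and j suffice, and by antisymmetry they amount to the entry (i, j) and two entries for
each of the m other indices. -/
lemma card_gram_stratum_le {m t : ℕ} (ht : t ≤ ℓ) {i j : Fin (m + 2)} (hne : i ≠ j) :
    #{M ∈ univ.image (gram (R := ZMod (p ^ ℓ)) (n := m + 2)) |
      (∀ a b, (p : ZMod (p ^ ℓ)) ^ t ∣ M a b) ∧
        (t = ℓ ∨ ¬ (p : ZMod (p ^ ℓ)) ^ (t + 1) ∣ M i j)} ≤ (p ^ (ℓ - t)) ^ (2 * m + 1) := by
  set D : Finset (ZMod (p ^ ℓ)) := {c | (p : ZMod (p ^ ℓ)) ^ t ∣ c}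
  have hD : #D ≤ p ^ (ℓ - t) := card_pow_dvd_le ht
  have hmem : ∀ c, c ∈ D ↔ (p : ZMod (p ^ ℓ)) ^ t ∣ c := by simp [D]
  have hidx : Fintype.card {a : Fin (m + 2) // a ≠ i ∧ a ≠ j} = m := by
    have h : ({a : Fin (m + 2) | a ≠ i ∧ a ≠ j} : Finset _) = univ \ {i, j} := by
      ext a; simp
    rw [Fintype.card_subtype, h, Finset.card_sdiff_of_subset (Finset.subset_univ _),
      Finset.card_pair hne]
    simp
  refine (Finset.card_le_card_of_injOn
    (t := D ×ˢ Fintype.piFinset fun _ : {a : Fin (m + 2) // a ≠ i ∧ a ≠ j} => D ×ˢ D)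
    (fun M => (M i j, fun a => (M i a, M j a))) ?_ ?_).trans ?_
  · intro M hM
    have hM := (Finset.mem_filter.1 hM).2.1
    simp [hmem, hM]
  · intro M hM M' hM' e
    obtain ⟨hM1, hM2, hM3⟩ := Finset.mem_filter.1 hM
    obtain ⟨hM1', hM2', -⟩ := Finset.mem_filter.1 hM'
    obtain ⟨x, -, rfl⟩ := Finset.mem_image.1 hM1
    obtain ⟨x', -, rfl⟩ := Finset.mem_image.1 hM1'
    simp only [Prod.mk.injEq] at e
    have hself : ∀ (y : Fin (m + 2) → Fin 2 → ZMod (p ^ ℓ)) a, gram y a a = 0 := by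
      intro y a; simp [gram, wedge, mul_comm]
    have hji : gram x j i = gram x' j i := by
      have := e.1
      simp only [gram] at this ⊢
      rw [wedge_swap (x j), wedge_swap (x' j), this]
    refine gram_eq_of_eq ht hM2 hM2' hM3 ?_ ?_ <;> intro a
    · by_cases hai : a = i
      · rw [hai, hself, hself]
      by_cases haj : a = j
      · rw [haj]; exact e.1
      exact (Prod.ext_iff.1 (congrFun e.2 ⟨a, hai, haj⟩)).1
    · by_cases hai : a = i
      · rw [hai]; exact hji
      by_cases haj : a = j
      · rw [haj, hself, hself]
      exact (Prod.ext_iff.1 (congrFun e.2 ⟨a, hai, haj⟩)).2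
  · rw [Finset.card_product, Fintype.card_piFinset]
    simp only [Finset.card_product, prod_const, card_univ, hidx]
    calc #D * (#D * #D) ^ m = #D ^ (2 * m + 1) := by ring
      _ ≤ _ := by gcongr

lemma exists_gram_stratum {m : ℕ} (x : Fin (m + 2) → Fin 2 → ZMod (p ^ ℓ)) :
    ∃ t ≤ ℓ, ∃ i j, i ≠ j ∧ (∀ a b, (p : ZMod (p ^ ℓ)) ^ t ∣ gram x a b) ∧
      (t = ℓ ∨ ¬ (p : ZMod (p ^ ℓ)) ^ (t + 1) ∣ gram x i j) := by
  classical
  set P : ℕ → Prop := fun t => ∀ a b, (p : ZMod (p ^ ℓ)) ^ t ∣ gram x a b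
  have h0 : P 0 := fun a b => by simp
  have hP : P (Nat.findGreatest P ℓ) := Nat.findGreatest_spec (Nat.zero_le ℓ) h0
  rcases (Nat.findGreatest_le (P := P) ℓ).eq_or_lt with h | h
  · exact ⟨_, h.le, 0, 1, by simp, hP, Or.inl h⟩
  · have h1 : ¬ P (Nat.findGreatest P ℓ + 1) :=
      Nat.findGreatest_is_greatest (P := P) (Nat.lt_succ_self _) h
    simp only [P, not_forall] at h1
    obtain ⟨i, j, hij⟩ := h1
    refine ⟨_, h.le, i, j, ?_, hP, Or.inr hij⟩
    rintro rfl
    exact hij (by simp [gram, wedge, mul_comm])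

lemma sum_range_pow_le_two_mul {b : ℕ} (hb : 2 ≤ b) (n : ℕ) :
    ∑ t ∈ Finset.range (n + 1), b ^ t ≤ 2 * b ^ n := by
  induction n with
  | zero => simp
  | succ n ih =>
    rw [Finset.sum_range_succ, pow_succ]
    nlinarith [pow_pos (show 0 < b by omega) n]

/-- The number of classes of configurations in the whole plane. -/
lemma card_image_gram_le (m : ℕ) :
    #(univ.image (gram (R := ZMod (p ^ ℓ)) (n := m + 2))) ≤
      2 * (m + 2) ^ 2 * (p ^ ℓ) ^ (2 * m + 1) := by
  set S : ℕ → Fin (m + 2) × Fin (m + 2) → Finset (Fin (m + 2) → Fin (m + 2) → ZMod (p ^ ℓ)) :=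
    fun t ij => {M ∈ univ.image (gram (R := ZMod (p ^ ℓ)) (n := m + 2)) |
      (∀ a b, (p : ZMod (p ^ ℓ)) ^ t ∣ M a b) ∧
        (t = ℓ ∨ ¬ (p : ZMod (p ^ ℓ)) ^ (t + 1) ∣ M ij.1 ij.2)}
  have hcover : univ.image (gram (R := ZMod (p ^ ℓ)) (n := m + 2)) ⊆
      (Finset.range (ℓ + 1)).biUnion fun t => (univ : Finset (Fin (m + 2))).offDiag.biUnion (S t) := by
    intro M hM
    obtain ⟨x, -, rfl⟩ := Finset.mem_image.1 hM
    obtain ⟨t, ht, i, j, hne, h1, h2⟩ := exists_gram_stratum x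
    simp only [Finset.mem_biUnion, Finset.mem_range, Finset.mem_offDiag]
    exact ⟨t, by omega, (i, j), ⟨mem_univ _, mem_univ _, hne⟩, Finset.mem_filter.2 ⟨hM, h1, h2⟩⟩
  have hp2 : 2 ≤ p := (Fact.out : p.Prime).two_le
  calc _ ≤ ∑ t ∈ Finset.range (ℓ + 1), ∑ ij ∈ (univ : Finset (Fin (m + 2))).offDiag, #(S t ij) :=
        (Finset.card_le_card hcover).trans <| Finset.card_biUnion_le.trans <|
          Finset.sum_le_sum fun t _ => Finset.card_biUnion_le
    _ ≤ ∑ t ∈ Finset.range (ℓ + 1), ∑ ij ∈ (univ : Finset (Fin (m + 2))).offDiag,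
        (p ^ (ℓ - t)) ^ (2 * m + 1) := by
        refine Finset.sum_le_sum fun t ht => Finset.sum_le_sum fun ij hij => ?_
        exact card_gram_stratum_le (Nat.lt_succ_iff.1 (Finset.mem_range.1 ht))
          (Finset.mem_offDiag.1 hij).2.2
    _ ≤ ∑ t ∈ Finset.range (ℓ + 1), (m + 2) ^ 2 * (p ^ (2 * m + 1)) ^ (ℓ - t) := by
        refine Finset.sum_le_sum fun t _ => ?_
        rw [Finset.sum_const, smul_eq_mul, pow_right_comm]
        gcongr
        rw [Finset.offDiag_card, card_univ, Fintype.card_fin, sq]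
        exact Nat.sub_le _ _
    _ = (m + 2) ^ 2 * ∑ t ∈ Finset.range (ℓ + 1), (p ^ (2 * m + 1)) ^ t := by
        rw [← Finset.mul_sum, ← Finset.sum_range_reflect (fun t => (p ^ (2 * m + 1)) ^ t)]
        rfl
    _ ≤ (m + 2) ^ 2 * (2 * (p ^ (2 * m + 1)) ^ ℓ) := by
        gcongr
        refine sum_range_pow_le_two_mul (hp2.trans ?_) ℓ
        exact Nat.le_self_pow (by omega) p
    _ = _ := by rw [pow_right_comm]; ring

end UpperBound

/-! ### Large p, small p, and the conclusion -/

section Main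

lemma natCard_configClasses_pos {R : Type*} [CommRing R] [Finite R] (n : ℕ) {E : Set (Fin 2 → R)}
    (hE : E.Nonempty) : 1 ≤ Nat.card (ConfigClasses n E) := by
  obtain ⟨x, hx⟩ := hE
  rw [natCard_configClasses]
  exact (Set.ncard_pos (Set.toFinite _)).2 ⟨_, fun _ => x, fun _ => hx, rfl⟩

lemma natCard_configClasses_one_le {R : Type*} [CommRing R] (E : Set (Fin 2 → R)) :
    Nat.card (ConfigClasses 1 E) ≤ 1 := by
  rw [natCard_configClasses]
  refine (Set.ncard_le_ncard (t := {0}) ?_).trans (Set.ncard_singleton _).le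
  rintro _ ⟨x, -, rfl⟩
  ext i j
  simp [gram, wedge, Subsingleton.elim i j, mul_comm]

/-- The size hypothesis raised to the `n`-th power. -/
lemma pow_le_of_rpow_le {n p ℓ : ℕ} (hn : 0 < n) (hp : 0 < p) (hℓ : 0 < ℓ) {C e : ℝ} (hC : 0 < C)
    (h : C * (ℓ : ℝ) ^ (2 / (n : ℝ)) * (p : ℝ) ^ ((ℓ : ℝ) * (2 - 1 / (ℓ * n))) ≤ e) :
    C ^ n * ℓ ^ 2 * ((p : ℝ) ^ ℓ) ^ (2 * n) ≤ p * e ^ n := by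
  have hp' : (0 : ℝ) < p := by exact_mod_cast hp
  have hℓ' : (0 : ℝ) < ℓ := by exact_mod_cast hℓ
  have hn' : (0 : ℝ) < n := by exact_mod_cast hn
  have h1 : ((ℓ : ℝ) ^ (2 / (n : ℝ))) ^ n = ℓ ^ 2 := by
    rw [← Real.rpow_natCast, ← Real.rpow_mul hℓ'.le, div_mul_cancel₀ _ hn'.ne']
    exact_mod_cast Real.rpow_natCast (ℓ : ℝ) 2
  -- Here nℓs = 2nℓ - 1, so one factor p completes the power.
  have h2 : (p : ℝ) * ((p : ℝ) ^ ((ℓ : ℝ) * (2 - 1 / (ℓ * n)))) ^ n =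
      ((p : ℝ) ^ ℓ) ^ (2 * n) := by
    rw [← Real.rpow_natCast ((p : ℝ) ^ ((ℓ : ℝ) * (2 - 1 / (ℓ * n)))), ← Real.rpow_mul hp'.le,
      ← pow_mul, ← Real.rpow_natCast (p : ℝ) (ℓ * (2 * n))]
    nth_rewrite 1 [← Real.rpow_one (p : ℝ)]
    rw [← Real.rpow_add hp']
    congr 1
    push_cast
    field_simp
    ring
  calc C ^ n * ℓ ^ 2 * ((p : ℝ) ^ ℓ) ^ (2 * n)
      = p * (C * (ℓ : ℝ) ^ (2 / (n : ℝ)) * (p : ℝ) ^ ((ℓ : ℝ) * (2 - 1 / (ℓ * n)))) ^ n := by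
        rw [mul_pow, mul_pow, h1, ← h2]; ring
    _ ≤ p * e ^ n := by gcongr

variable {p ℓ : ℕ} [Fact p.Prime]

lemma natCard_configClasses_univ_le (m : ℕ) :
    Nat.card (ConfigClasses (m + 2) (Set.univ : Set (Fin 2 → ZMod (p ^ ℓ)))) ≤
      2 * (m + 2) ^ 2 * (p ^ ℓ) ^ (2 * m + 1) := by
  refine le_trans (le_of_eq ?_) (card_image_gram_le m)
  rw [natCard_configClasses, ← Set.ncard_coe_finset]
  simp

/-- Large subsets of the plane determine a positive proportion of all classes when `p` is large. -/
lemma pow_le_natCard_configClasses (hℓ : 0 < ℓ) (m : ℕ) {C : ℝ} (hC : 0 < C)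
    (E : Set (Fin 2 → ZMod (p ^ ℓ)))
    (h : C ^ (m + 2) * ℓ ^ 2 * ((p : ℝ) ^ ℓ) ^ (2 * (m + 2)) ≤ p * (E.ncard : ℝ) ^ (m + 2))
    (hlarge : (4 / C) ^ (m + 2) ≤ p) :
    ((p : ℝ) ^ ℓ) ^ (2 * m + 1) ≤ 4 * 2 ^ (m + 2) * (1 + 2 / (C / 2) ^ (m + 2)) *
      Nat.card (ConfigClasses (m + 2) E) := by
  classical
  have hp1 : (1 : ℝ) ≤ p := by exact_mod_cast (Fact.out : p.Prime).one_le
  have hp : (0 : ℝ) < p := by linarith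
  have hl : (1 : ℝ) ≤ ℓ := by exact_mod_cast hℓ
  set F : Finset (Fin 2 → ZMod (p ^ ℓ)) := {x | x ∈ E} with hF
  have hFE : E.ncard = #F := by
    rw [← Set.ncard_coe_finset]; simp [hF]
  set F' : Finset (Fin 2 → ZMod (p ^ ℓ)) := {x ∈ F | IsPrimitiveVec x}
  have hcard : (#F : ℝ) ≤ #F' + ((p : ℝ) ^ ℓ / p) ^ 2 := by
    have h1 : #F ≤ #F' + (p ^ (ℓ - 1)) ^ 2 := by
      rw [← Finset.card_filter_add_card_filter_not (s := F) (fun x => IsPrimitiveVec x)]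
      refine Nat.add_le_add_left (le_trans (Finset.card_le_card ?_)
        (card_not_isPrimitiveVec_le hℓ)) _
      exact Finset.filter_subset_filter _ (Finset.subset_univ _)
    have h4 : (p : ℝ) ^ (ℓ - 1) = (p : ℝ) ^ ℓ / p := by
      rw [eq_div_iff hp.ne', ← pow_succ]; congr 1; omega
    rw [← h4]; exact_mod_cast h1
  rw [hFE] at h
  have hq : (0 : ℝ) < (p : ℝ) ^ ℓ := by positivity
  -- Compare n-th powers; as n = m + 2 ≥ 2, the spare factor p absorbs (4/C)^n. The 4 leaves room
  -- for halving the set.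
  have hbig : 4 * ((p : ℝ) ^ ℓ) ^ 2 ≤ p * #F := by
    refine le_of_pow_le_pow_left₀ (n := m + 2) (by omega) (by positivity) ?_
    set q : ℝ := (p : ℝ) ^ ℓ
    calc (4 * q ^ 2) ^ (m + 2) = (4 / C) ^ (m + 2) * (C ^ (m + 2) * 1 ^ 2 * q ^ (2 * (m + 2))) := by
          rw [div_pow, mul_pow, ← pow_mul]; field_simp
      _ ≤ p * (C ^ (m + 2) * ℓ ^ 2 * q ^ (2 * (m + 2))) := by gcongr
      _ ≤ p * (p * #F ^ (m + 2)) := by gcongr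
      _ ≤ p ^ (m + 1) * (p * #F ^ (m + 2)) := by
          gcongr
          exact le_self_pow₀ hp1 (by omega)
      _ = _ := by ring
  have hsmall : ((p : ℝ) ^ ℓ / p) ^ 2 ≤ #F / 2 := by
    rw [div_pow, div_le_div_iff₀ (by positivity) two_pos]
    nlinarith [mul_nonneg (Nat.cast_nonneg (α := ℝ) #F) (mul_nonneg hp.le (sub_nonneg.2 hp1))]
  have hhalf : (#F : ℝ) / 2 ≤ #F' := by linarith
  have hA : (0 : ℝ) < (C / 2) ^ (m + 2) := by positivity
  have key := pow_le_card_image_gram hℓ m (E := F')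
    (fun x hx => (Finset.mem_filter.1 hx).2) hA (by nlinarith) (by
      calc (C / 2) ^ (m + 2) * ℓ * ((p : ℝ) ^ ℓ) ^ (2 * (m + 2))
          ≤ (C / 2) ^ (m + 2) * ℓ ^ 2 * ((p : ℝ) ^ ℓ) ^ (2 * (m + 2)) := by
            gcongr
            exact le_self_pow₀ hl two_ne_zero
        _ = (C ^ (m + 2) * ℓ ^ 2 * ((p : ℝ) ^ ℓ) ^ (2 * (m + 2))) / 2 ^ (m + 2) := by
            rw [div_pow]; ring
        _ ≤ (p * #F ^ (m + 2)) / 2 ^ (m + 2) := by gcongr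
        _ = p * (#F / 2) ^ (m + 2) := by rw [div_pow]; ring
        _ ≤ _ := by gcongr)
  refine key.trans ?_
  gcongr
  rw [natCard_configClasses, ← Set.ncard_coe_finset]
  refine Set.ncard_le_ncard ?_ (Set.toFinite _)
  rw [Finset.coe_image]
  refine Set.image_mono fun x hx i => ?_
  have hx := Fintype.mem_piFinset.1 (Finset.mem_filter.1 hx).1 i
  simpa [hF] using (Finset.mem_filter.1 hx).1

/-- When `p` is bounded, the size hypothesis bounds `ℓ`, hence the modulus. -/
lemma pow_le_of_lt {m N L : ℕ} {C : ℝ} (hC : 0 < C) (E : Set (Fin 2 → ZMod (p ^ ℓ)))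
    (h : C ^ (m + 2) * ℓ ^ 2 * ((p : ℝ) ^ ℓ) ^ (2 * (m + 2)) ≤ p * (E.ncard : ℝ) ^ (m + 2))
    (hN : p ≤ N) (hL : N / C ^ (m + 2) ≤ L) :
    ((p : ℝ) ^ ℓ) ^ (2 * m + 1) ≤ ((N : ℝ) ^ L) ^ (2 * m + 1) := by
  have hp1 : (1 : ℝ) ≤ p := by exact_mod_cast (Fact.out : p.Prime).one_le
  have hpN : (p : ℝ) ≤ N := by exact_mod_cast hN
  have hE : (E.ncard : ℝ) ≤ ((p : ℝ) ^ ℓ) ^ 2 := by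
    have := Set.ncard_le_card E
    rw [Nat.card_eq_fintype_card, Fintype.card_pi_const, ZMod.card] at this
    exact_mod_cast this
  have hq : (0 : ℝ) < (p : ℝ) ^ ℓ := by positivity
  -- The trivial bound |E| ≤ q² cancels the powers of q in the hypothesis.
  have h1 : C ^ (m + 2) * (ℓ : ℝ) ^ 2 ≤ p := by
    refine le_of_mul_le_mul_right (h.trans ?_) (pow_pos hq (2 * (m + 2)))
    rw [pow_mul]
    gcongr
  have h2 : ℓ ≤ L := by
    have h3 : (ℓ : ℝ) ^ 2 ≤ L := by
      refine le_trans ?_ hL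
      rw [le_div_iff₀ (by positivity)]
      linarith
    exact (Nat.le_self_pow two_ne_zero ℓ).trans (by exact_mod_cast h3)
  gcongr
  exact (pow_le_pow_left₀ (by positivity) hpN ℓ).trans (pow_le_pow_right₀ (hp1.trans hpN) h2)

end Main

theorem theorem1p3 (k : ℕ) (C : ℝ) (hC : 0 < C) :
    ∃ c : ℝ, 0 < c ∧
      ∀ p ℓ : ℕ, p.Prime → p ≠ 2 → 1 ≤ ℓ →
        ∀ s : ℝ, s = 2 - 1 / ((ℓ : ℝ) * ((k : ℝ) + 1)) →
          ∀ E : Set (Fin 2 → ZMod (p ^ ℓ)),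
            C * (ℓ : ℝ) ^ (2 / ((k : ℝ) + 1)) * (p : ℝ) ^ ((ℓ : ℝ) * s) ≤ (E.ncard : ℝ) →
              c * (Nat.card (ConfigClasses (k + 1)
                    (Set.univ : Set (Fin 2 → ZMod (p ^ ℓ)))) : ℝ) ≤
                (Nat.card (ConfigClasses (k + 1) E) : ℝ) := by
  have hne : ∀ p ℓ : ℕ, p.Prime → 1 ≤ ℓ → ∀ s : ℝ, ∀ E : Set (Fin 2 → ZMod (p ^ ℓ)),
      C * (ℓ : ℝ) ^ (2 / ((k : ℝ) + 1)) * (p : ℝ) ^ ((ℓ : ℝ) * s) ≤ (E.ncard : ℝ) →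
        (1 : ℝ) ≤ Nat.card (ConfigClasses (k + 1) E) := by
    intro p ℓ hp hℓ s E hE
    have : Fact p.Prime := ⟨hp⟩
    have hp0 : (0 : ℝ) < p := by exact_mod_cast hp.pos
    have hℓ0 : (0 : ℝ) < ℓ := by exact_mod_cast hℓ
    have hpos : (0 : ℝ) < E.ncard := lt_of_lt_of_le (by positivity) hE
    have hpos : 0 < E.ncard := by exact_mod_cast hpos
    exact_mod_cast natCard_configClasses_pos (k + 1) (Set.nonempty_of_ncard_ne_zero hpos.ne')
  rcases k with _ | m
  -- For k = 0 the only wedge is x ∧ x = 0, so there is one class.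
  · refine ⟨1, one_pos, fun p ℓ hp _ hℓ s _ E hE => ?_⟩
    rw [one_mul]
    refine le_trans ?_ (hne p ℓ hp hℓ s E hE)
    exact_mod_cast natCard_configClasses_one_le (Set.univ : Set (Fin 2 → ZMod (p ^ ℓ)))
  · set N : ℕ := ⌈(4 / C) ^ (m + 2)⌉₊
    set L : ℕ := ⌈N / C ^ (m + 2)⌉₊
    set K : ℝ := 4 * 2 ^ (m + 2) * (1 + 2 / (C / 2) ^ (m + 2)) with hK
    set B : ℝ := ((N : ℝ) ^ L) ^ (2 * m + 1)
    have hK0 : 0 < K := by positivity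
    have hB0 : 0 ≤ B := by positivity
    -- `K` serves p ≥ (4/C)^(m+2), `B` bounds q^(2m+1) for smaller p, and 2(m+2)² comes from the
    -- upper bound.
    refine ⟨1 / (2 * (m + 2) ^ 2 * (K + B)), by positivity, fun p ℓ hp _ hℓ s hs E hE => ?_⟩
    have hcl := hne p ℓ hp hℓ s E hE
    have : Fact p.Prime := ⟨hp⟩
    have hn : ((m + 1 : ℕ) : ℝ) + 1 = ((m + 2 : ℕ) : ℝ) := by push_cast; ring
    rw [hs, hn] at hE
    have hpow := pow_le_of_rpow_le (by omega) hp.pos hℓ hC hE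
    have htotal : (Nat.card (ConfigClasses (m + 2)
        (Set.univ : Set (Fin 2 → ZMod (p ^ ℓ)))) : ℝ) ≤
        2 * (m + 2) ^ 2 * ((p : ℝ) ^ ℓ) ^ (2 * m + 1) := by
      exact_mod_cast natCard_configClasses_univ_le m
    change _ * (Nat.card (ConfigClasses (m + 2) _) : ℝ) ≤ Nat.card (ConfigClasses (m + 2) E)
    change (1 : ℝ) ≤ Nat.card (ConfigClasses (m + 2) E) at hcl
    set T : ℝ := (Nat.card (ConfigClasses (m + 2) E) : ℝ)
    have hlow : ((p : ℝ) ^ ℓ) ^ (2 * m + 1) ≤ (K + B) * T := by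
      by_cases hlarge : (4 / C) ^ (m + 2) ≤ p
      · refine (pow_le_natCard_configClasses hℓ m hC E hpow hlarge).trans ?_
        gcongr
        linarith
      · refine (pow_le_of_lt (N := N) hC E hpow ?_ (Nat.le_ceil _)).trans ?_
        · have := (lt_of_not_ge hlarge).le.trans (Nat.le_ceil _)
          exact_mod_cast this
        · change B ≤ _
          nlinarith
    rw [one_div, inv_mul_le_iff₀ (by positivity)]
    calc _ ≤ _ := htotal
      _ ≤ 2 * (m + 2) ^ 2 * ((K + B) * T) := by gcongr
      _ = _ := by ring
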